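/- Conventions. A \emph{sub-distribution} on a set $A$ is a map $\mu : A \to [0,1]$ with $|\mu| := \sum_{a \in A} \mu(a) \le 1$; it is a \emph{proper distribution} if $|\mu| = 1$. Let $\mathbb{D}(A)$ be the set of sub-distributions on $A$, and write $\mu[E] = \sum_{x \in E} \mu(x)$ for $E \subseteq A$. For $\varepsilon \ge 0$ and $\mu_1, \mu_2 \in \mathbb{D}(A)$ let $\Delta_\varepsilon(\mu_1, \mu_2) = \sup_{E \subseteq A} \left(\mu_1[E] - e^{\varepsilon} \mu_2[E]\right)$. Write $A^\star = A \uplus \{\star\}$. For $\mu_1 \in \mathbb{D}(A)$, $\mu_2 \in \mathbb{D}(B)$, $\varepsilon, \delta \ge 0$ and a relation $\mathcal{R} \subseteq A \times B$, an \emph{$(\varepsilon, \delta)$-approximate symmetric $\star$-lifting} of $\mu_1$ and $\mu_2$ for $\mathcal{R}$ is a pair $\eta_L \in \mathbb{D}(A \times B^\star)$, $\eta_R \in \mathbb{D}(A^\star \times B)$ such that the first marginal of $\eta_L$ is $\mu_1$ and the second marginal of $\eta_R$ is $\mu_2$; for all $(a,b) \in A \times B$, if $\eta_L(a,b) \neq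 0$ or $\eta_R(a,b) \neq 0$ then $(a,b) \in \mathcal{R}$; and $\Delta_\varepsilon(\overline{\eta_L}, \overline{\eta_R}) \le \delta$ and $\Delta_\varepsilon(\overline{\eta_R}, \overline{\eta_L}) \le \delta$, where $\overline{\eta_L}, \overline{\eta_R} \in \mathbb{D}(A^\star \times B^\star)$ are the extensions by zero. The $n$-fold Kleisli composition of maps $f_i : A_i \to \mathbb{D}(A_{i+1})$, $0 \le i < n$, is the map $F : A_0 \to \mathbb{D}(A_n)$ with $F(a) = \mu_n$, where $\mu_0$ is the Dirac distribution at $a$ and $\mu_{i+1}(x) = \sum_{y \in A_i} \mu_i(y)\, f_i(y)(x)$. Corollary (advanced composition for symmetric $\star$-liftings). Let $n \ge 0$ be a natural number, $\varepsilon, \delta \ge 0$ and $\omega \in (0,1)$ real numbers. Let $A_0, \dots, A_n$ and $B_0, \dots, B_n$ be sets, $\mathcal{R}(i) \subseteq A_i \times B_i$ relations for $0 \le i \le n$, and $f_i : A_i \to \mathbb{D}(A_{i+1})$, $g_i : B_i \to \mathbb{D}(B_{i+1})$ maps for $0 \le i < n$. Suppose that for all $0 \le i < n$ and all $(a,b)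 \in \mathcal{R}(i)$ there is an $(\varepsilon, \delta)$-approximate symmetric $\star$-lifting of $f_i(a)$ and $g_i(b)$ for $\mathcal{R}(i+1)$, and that $f_i(a)$ and $g_i(b)$ are proper distributions. Let $F : A_0 \to \mathbb{D}(A_n)$ and $G : B_0 \to \mathbb{D}(B_n)$ be the $n$-fold Kleisli compositions of $(f_i)$ and $(g_i)$. Then for every $(a_0, b_0) \in \mathcal{R}(0)$ there is an $(\varepsilon', \delta')$-approximate symmetric $\star$-lifting of $F(a_0)$ and $G(b_0)$ for $\mathcal{R}(n)$, where \[ \varepsilon' = \varepsilon \sqrt{2 n \ln(1/\omega)} + n \varepsilon (e^{\varepsilon} - 1), \qquad \delta' = n \delta + \omega . \] -/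

import Mathlib

open scoped ENNReal

universe u v

/-- A (discrete) sub-distribution on `A`: a mass function whose total weight is at most `1`.
Each mass is then at most `1` and the support is automatically countable, because a convergent
sum of nonnegative terms has only countably many nonzero terms. -/
structure SubDist (A : Type u) : Type u where
  mass : A → ℝ≥0∞
  tsum_mass_le_one : ∑' a, mass a ≤ 1

namespace SubDist

instance {A : Type u} : CoeFun (SubDist A) (fun _ => A → ℝ≥0∞) := ⟨SubDist.mass⟩

/-- The weight `|μ|`. -/
noncomputable def weight {A : Type u} (μ : SubDist A) : ℝ≥0∞ := ∑' a, μ a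

/-- A proper distribution is a sub-distribution of weight one. -/
def IsProper {A : Type u} (μ : SubDist A) : Prop := μ.weight = 1

/-- The probability `μ[E] = ∑_{x ∈ E} μ x` of an event `E`. -/
noncomputable def prob {A : Type u} (μ : SubDist A) (E : Set A) : ℝ≥0∞ :=
  ∑' x, E.indicator μ x

theorem prob_le_one {A : Type u} (μ : SubDist A) (E : Set A) : μ.prob E ≤ 1 :=
  (ENNReal.tsum_le_tsum fun x => Set.indicator_le_self' (fun _ _ => zero_le) x).trans
    μ.tsum_mass_le_one

/-- The Dirac distribution centered at `a`. -/
noncomputable def dirac {A : Type u} (a : A) : SubDist A where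
  mass := Set.indicator {a} (fun _ => 1)
  tsum_mass_le_one := by
    rw [← tsum_subtype]
    simp

/-- Monadic bind: `b ↦ ∑_a μ(a) · f(a)(b)`. -/
noncomputable def bind {A : Type u} {B : Type v} (μ : SubDist A) (f : A → SubDist B) :
    SubDist B where
  mass b := ∑' a, μ a * f a b
  tsum_mass_le_one := by
    rw [ENNReal.tsum_comm]
    refine le_trans (ENNReal.tsum_le_tsum fun a => ?_) μ.tsum_mass_le_one
    rw [ENNReal.tsum_mul_left]
    exact mul_le_of_le_one_right zero_le (f a).tsum_mass_le_one

/-- The lifting of a function `f : A → B` to sub-distributions. -/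
noncomputable def map {A : Type u} {B : Type v} (f : A → B) (μ : SubDist A) : SubDist B :=
  μ.bind fun a => dirac (f a)

/-- The `ε`-DP divergence `Δ_ε(μ₁, μ₂) = sup_E (μ₁[E] - e^ε μ₂[E])`, a supremum of a family of
real numbers that is nonempty and bounded above (see `bddAbove_dpDivergence`). -/
noncomputable def dpDivergence {B : Type u} (ε : ℝ) (μ₁ μ₂ : SubDist B) : ℝ :=
  ⨆ E : Set B, ((μ₁.prob E).toReal - Real.exp ε * (μ₂.prob E).toReal)

theorem bddAbove_dpDivergence {B : Type u} (ε : ℝ) (μ₁ μ₂ : SubDist B) :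
    BddAbove (Set.range fun E : Set B =>
      ((μ₁.prob E).toReal - Real.exp ε * (μ₂.prob E).toReal)) := by
  refine ⟨1, ?_⟩
  rintro _ ⟨E, rfl⟩
  have h1 : (μ₁.prob E).toReal ≤ 1 :=
    ENNReal.toReal_le_of_le_ofReal zero_le_one (by simpa using μ₁.prob_le_one E)
  have h2 : 0 ≤ Real.exp ε * (μ₂.prob E).toReal := by positivity
  show (μ₁.prob E).toReal - Real.exp ε * (μ₂.prob E).toReal ≤ 1
  linarith

/-- `(ηL, ηR)` is an `(ε, δ)`-approximate symmetric `⋆`-lifting of `μ₁` and `μ₂` for `R`.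
The set `A^⋆ = A ⊎ {⋆}` is `Option A`, with `⋆ = none`. -/
structure IsSymStarLifting {A : Type u} {B : Type v} (R : A → B → Prop) (ε δ : ℝ)
    (μ₁ : SubDist A) (μ₂ : SubDist B)
    (ηL : SubDist (A × Option B)) (ηR : SubDist (Option A × B)) : Prop where
  fst_marginal : ηL.map Prod.fst = μ₁
  snd_marginal : ηR.map Prod.snd = μ₂
  left_support : ∀ a b, ηL (a, some b) ≠ 0 → R a b
  right_support : ∀ a b, ηR (some a, b) ≠ 0 → R a b
  left_right : dpDivergence ε
    (ηL.map (Prod.map some id) : SubDist (Option A × Option B)) (ηR.map (Prod.map id some)) ≤ δ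
  right_left : dpDivergence ε
    (ηR.map (Prod.map id some) : SubDist (Option A × Option B)) (ηL.map (Prod.map some id)) ≤ δ

/-- `μ₁` and `μ₂` are related by an `(ε, δ)`-approximate symmetric `⋆`-lifting of `R`. -/
def SymStarLift {A : Type u} {B : Type v} (R : A → B → Prop) (ε δ : ℝ)
    (μ₁ : SubDist A) (μ₂ : SubDist B) : Prop :=
  ∃ (ηL : SubDist (A × Option B)) (ηR : SubDist (Option A × B)),
    IsSymStarLifting R ε δ μ₁ μ₂ ηL ηR

/-- The result of running `f 0, …, f (i - 1)` in sequence from the initial value `a`. -/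
noncomputable def run {n : ℕ} {A : Fin (n + 1) → Type u}
    (f : (i : Fin n) → A i.castSucc → SubDist (A i.succ)) (a : A 0) (i : Fin (n + 1)) :
    SubDist (A i) :=
  Fin.induction (motive := fun i => SubDist (A i)) (dirac a) (fun j μ => μ.bind (f j)) i

/-- The `n`-fold Kleisli composition `A 0 → SubDist (A n)` of `f 0, …, f (n - 1)`. -/
noncomputable def kleisliComp {n : ℕ} {A : Fin (n + 1) → Type u}
    (f : (i : Fin n) → A i.castSucc → SubDist (A i.succ)) (a : A 0) :
    SubDist (A (Fin.last n)) :=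
  run f a (Fin.last n)

end SubDist

/-! Advanced composition is proved through exponential moments of the privacy loss.
Indistinguishability is replaced by the relation `MomentClose`, in which `a = 1 / (1 + l)` encodes
the moment of order `l`. This form avoids quotients of masses and leaves room for an additive error.
By Hölder's inequality, bind multiplies the moment bounds and adds the errors (`MomentClose.bind`).
`MomentLift.bind` carries this over to liftings, so `n` steps give `C ^ n` and `n * d`.

For one step, two (ε, δ)-close proper distributions contain parts of equal weight at least 1 - δ
with pointwise ratio at most e^ε (`exists_common_weight_parts`). These parts post-process randomised
response (`exists_randomizedResponse`), whose moment is at most exp(lε(e^ε - 1) + (lε)²/2)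
(`Real.randomizedResponse_moment_le`).

A Chernoff-type bound (`MomentClose.prob_le`) finally turns the n-fold moment bound into an (ε', δ')
bound. The optimal `l` gives an excess of exactly ω. -/

/-- Hölder's inequality for unconditional sums, with weights `a` and `1 - a`. -/
theorem ENNReal.tsum_rpow_mul_rpow_le {ι : Type*} (f g : ι → ℝ≥0∞) {a : ℝ}
    (ha : 0 ≤ a) (ha1 : a ≤ 1) :
    ∑' i, f i ^ a * g i ^ (1 - a) ≤ (∑' i, f i) ^ a * (∑' i, g i) ^ (1 - a) := by
  let : MeasurableSpace ι := ⊤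
  simpa only [MeasureTheory.lintegral_count] using
    ENNReal.lintegral_mul_norm_pow_le (μ := MeasureTheory.Measure.count) (f := f) (g := g)
      (measurable_from_top.aemeasurable) (measurable_from_top.aemeasurable)
      ha (sub_nonneg.2 ha1) (add_sub_cancel a 1)

namespace SubDist

/-! ### Monad laws and supports for sub-distributions. -/

@[ext]
theorem ext {A : Type u} {μ ν : SubDist A} (h : ∀ a, μ a = ν a) : μ = ν := by
  cases μ; cases ν
  congr
  exact funext h

theorem bind_apply {A : Type u} {B : Type v} (μ : SubDist A) (f : A → SubDist B) (b : B) :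
    μ.bind f b = ∑' a, μ a * f a b := rfl

theorem dirac_apply {A : Type u} [DecidableEq A] (a b : A) :
    dirac a b = if b = a then 1 else 0 := by
  simp [dirac, Pi.single_apply]

theorem bind_bind {A B C : Type*} (μ : SubDist A) (f : A → SubDist B) (g : B → SubDist C) :
    (μ.bind f).bind g = μ.bind fun a => (f a).bind g := by
  ext c
  simp only [bind_apply, ← ENNReal.tsum_mul_right, ← ENNReal.tsum_mul_left, mul_assoc]
  exact ENNReal.tsum_comm

theorem dirac_bind {A B : Type*} (a : A) (f : A → SubDist B) : (dirac a).bind f = f a := by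
  classical
  ext b
  simp [bind_apply, dirac_apply]

theorem map_bind {A B C : Type*} (μ : SubDist A) (f : A → SubDist B) (e : B → C) :
    (μ.bind f).map e = μ.bind fun a => (f a).map e :=
  bind_bind _ _ _

theorem bind_map {A B C : Type*} (μ : SubDist A) (e : A → B) (f : B → SubDist C) :
    (μ.map e).bind f = μ.bind fun a => f (e a) := by
  simp only [map, bind_bind, dirac_bind]

theorem map_dirac {A B : Type*} (a : A) (e : A → B) : (dirac a).map e = dirac (e a) :=
  dirac_bind _ _

theorem map_map {A B C : Type*} (μ : SubDist A) (e : A → B) (e' : B → C) :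
    (μ.map e).map e' = μ.map (e' ∘ e) :=
  bind_map _ _ _

theorem map_id {A : Type*} (μ : SubDist A) : μ.map id = μ := by
  classical
  ext b
  simp [map, bind_apply, dirac_apply]

theorem bind_congr {A B : Type*} (μ : SubDist A) {f g : A → SubDist B}
    (h : ∀ a, μ a ≠ 0 → f a = g a) : μ.bind f = μ.bind g := by
  ext b
  refine tsum_congr fun a => ?_
  by_cases ha : μ a = 0
  · simp [ha]
  · rw [h a ha]

theorem bind_apply_ne_zero {A B : Type*} {μ : SubDist A} {f : A → SubDist B} {b : B}
    (h : μ.bind f b ≠ 0) : ∃ a, μ a ≠ 0 ∧ f a b ≠ 0 := by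
  contrapose! h
  refine ENNReal.tsum_eq_zero.2 fun a => ?_
  by_cases ha : μ a = 0
  · simp [ha]
  · simp [h a ha]

theorem map_apply_ne_zero {A B : Type*} {μ : SubDist A} {e : A → B} {b : B}
    (h : μ.map e b ≠ 0) : ∃ a, μ a ≠ 0 ∧ e a = b := by
  classical
  obtain ⟨a, ha, hb⟩ := bind_apply_ne_zero h
  refine ⟨a, ha, ?_⟩
  simp only [dirac_apply] at hb
  by_contra hne
  exact hb (if_neg fun h => hne h.symm)

theorem dirac_apply_ne_zero {A : Type*} {a b : A} (h : dirac a b ≠ 0) : b = a := by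
  classical
  simp only [dirac_apply] at h
  by_contra hne
  exact h (if_neg hne)

theorem weight_map {A B : Type*} (μ : SubDist A) (e : A → B) : (μ.map e).weight = μ.weight := by
  classical
  simp only [weight, map, bind_apply]
  rw [ENNReal.tsum_comm]
  refine tsum_congr fun a => ?_
  simp [dirac_apply]

/-- The sub-distribution without mass. -/
noncomputable def zero (A : Type*) : SubDist A where
  mass _ := 0
  tsum_mass_le_one := by simp

theorem zero_apply {A : Type*} (a : A) : zero A a = 0 := rfl

theorem zero_map {A B : Type*} (e : A → B) : (zero A).map e = zero B := by
  ext b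
  simp [map, bind_apply, zero_apply]

/-! ### Moment closeness: composition and tail bound. -/

/-- Up to an error of weight at most `d`, the mass function `P` is at most a weighted geometric
mean `W ^ a * Q ^ (1 - a)` where `W` has weight at most `C`. For `a = 1 / (1 + l)` and `d = 0` this
says that the moment `∑ P ^ (1 + l) * Q ^ (-l)` is at most `C`. -/
def MomentClose {S : Type*} (a : ℝ) (C d : ℝ≥0∞) (P Q : SubDist S) : Prop :=
  ∃ D W : S → ℝ≥0∞, ∑' x, D x ≤ d ∧ ∑' x, W x ≤ C ∧
    ∀ x, P x ≤ W x ^ a * Q x ^ (1 - a) + D x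

theorem MomentClose.refl {S : Type*} {a : ℝ} {C : ℝ≥0∞} (ha : 0 ≤ a) (ha1 : a ≤ 1) (hC : 1 ≤ C)
    (d : ℝ≥0∞) (P : SubDist S) : MomentClose a C d P P := by
  refine ⟨0, P, by simp, P.tsum_mass_le_one.trans hC, fun x => ?_⟩
  rw [← ENNReal.rpow_add_of_nonneg _ _ ha (sub_nonneg.2 ha1)]
  simp

/-- For fixed output, Hölder over the intermediate state turns a sum of geometric means into a
geometric mean of sums. The first error is transported by `f`, and the second is averaged over `P`.
-/
theorem MomentClose.bind {S T : Type*} {a : ℝ} (ha : 0 ≤ a) (ha1 : a ≤ 1) {C₁ C₂ d₁ d₂ : ℝ≥0∞}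
    {P Q : SubDist S} {f g : S → SubDist T} (h : MomentClose a C₁ d₁ P Q)
    (hfg : ∀ s, MomentClose a C₂ d₂ (f s) (g s)) :
    MomentClose a (C₁ * C₂) (d₁ + d₂) (P.bind f) (Q.bind g) := by
  obtain ⟨D₁, W₁, hD₁, hW₁, hPQ⟩ := h
  choose D₂ W₂ hD₂ hW₂ hfg using hfg
  have ha1' : 0 ≤ 1 - a := sub_nonneg.2 ha1
  refine ⟨fun x => ∑' s, (D₁ s * f s x + P s * D₂ s x), fun x => ∑' s, W₁ s * W₂ s x,
    ?_, ?_, fun x => ?_⟩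
  · rw [ENNReal.tsum_comm]
    simp only [ENNReal.tsum_add, ENNReal.tsum_mul_left]
    refine add_le_add (le_trans (ENNReal.tsum_le_tsum fun s => ?_) hD₁) ?_
    · exact mul_le_of_le_one_right' (f s).tsum_mass_le_one
    · refine (ENNReal.tsum_le_tsum fun s => mul_le_mul_right (hD₂ s) _).trans ?_
      rw [ENNReal.tsum_mul_right]
      exact mul_le_of_le_one_left' P.tsum_mass_le_one
  · rw [ENNReal.tsum_comm]
    simp only [ENNReal.tsum_mul_left]
    refine (ENNReal.tsum_le_tsum fun s => mul_le_mul_right (hW₂ s) _).trans ?_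
    rw [ENNReal.tsum_mul_right]
    exact mul_le_mul_left hW₁ _
  · have key : ∀ s, P s * f s x ≤ (W₁ s * W₂ s x) ^ a * (Q s * g s x) ^ (1 - a)
        + (D₁ s * f s x + P s * D₂ s x) := by
      intro s
      set M := W₁ s ^ a * Q s ^ (1 - a) with hM
      -- Truncating at `P s` lets the second error be weighted by `P`, of total mass at most 1, and
      -- not by `M`. This keeps the errors additive.
      have h1 : P s ≤ min (P s) M + D₁ s := by
        rcases le_total (P s) M with h | h
        · rw [min_eq_left h]; exact le_self_add
        · rw [min_eq_right h]; exact hPQ s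
      calc P s * f s x ≤ min (P s) M * f s x + D₁ s * f s x := by
            rw [← add_mul]; gcongr
        _ ≤ min (P s) M * (W₂ s x ^ a * g s x ^ (1 - a) + D₂ s x) + D₁ s * f s x := by
            gcongr; exact hfg s x
        _ ≤ M * (W₂ s x ^ a * g s x ^ (1 - a)) + P s * D₂ s x + D₁ s * f s x := by
            rw [mul_add]
            gcongr
            · exact min_le_right _ _
            · exact min_le_left _ _
        _ = _ := by
            rw [ENNReal.mul_rpow_of_nonneg _ _ ha, ENNReal.mul_rpow_of_nonneg _ _ ha1', hM]
            ring
    refine (ENNReal.tsum_le_tsum key).trans ?_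
    rw [ENNReal.tsum_add]
    gcongr
    exact ENNReal.tsum_rpow_mul_rpow_le _ _ ha ha1

theorem prob_mono_add {S : Type*} {P : SubDist S} {M D : S → ℝ≥0∞} (h : ∀ x, P x ≤ M x + D x)
    (E : Set S) : P.prob E ≤ ∑' x, E.indicator M x + ∑' x, D x := by
  rw [← ENNReal.tsum_add]
  refine ENNReal.tsum_le_tsum fun x => ?_
  by_cases hx : x ∈ E
  · simpa [hx] using h x
  · simp [hx]

/-- The constraint on `s` and `t` allows rescaling both factors of the geometric mean, which is then
at most the sum of its arguments. This plays the role of Markov's inequality in a Chernoff bound. -/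
theorem MomentClose.prob_le {S : Type*} {a : ℝ} (ha : 0 ≤ a) (ha1 : a ≤ 1) {C d : ℝ≥0∞}
    {P Q : SubDist S} (h : MomentClose a C d P Q) {s t : ℝ≥0∞} (hst : s ^ a * t ^ (1 - a) = 1)
    (E : Set S) : P.prob E ≤ t * Q.prob E + (d + s * C) := by
  obtain ⟨D, W, hD, hW, hPQ⟩ := h
  have ha1' : 0 ≤ 1 - a := sub_nonneg.2 ha1
  have key : ∀ x, P x ≤ t * Q x + (D x + s * W x) := by
    intro x
    refine (hPQ x).trans ?_
    have : W x ^ a * Q x ^ (1 - a) ≤ t * Q x + s * W x := by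
      calc W x ^ a * Q x ^ (1 - a) = (s * W x) ^ a * (t * Q x) ^ (1 - a) := by
            rw [ENNReal.mul_rpow_of_nonneg _ _ ha, ENNReal.mul_rpow_of_nonneg _ _ ha1',
              mul_mul_mul_comm, hst, one_mul]
        _ ≤ (t * Q x + s * W x) ^ a * (t * Q x + s * W x) ^ (1 - a) := by
            gcongr
            · exact le_add_self
            · exact le_self_add
        _ = _ := by
            rw [← ENNReal.rpow_add_of_nonneg _ _ ha ha1']
            simp
    calc _ ≤ t * Q x + s * W x + D x := by gcongr
      _ = _ := by ring
  refine (prob_mono_add key E).trans (add_le_add ?_ ?_)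
  · rw [prob, ← ENNReal.tsum_mul_left]
    refine ENNReal.tsum_le_tsum fun x => ?_
    by_cases hx : x ∈ E <;> simp [hx]
  · rw [ENNReal.tsum_add, ENNReal.tsum_mul_left]
    gcongr

theorem prob_ne_top {S : Type*} (P : SubDist S) (E : Set S) : P.prob E ≠ ∞ :=
  ne_top_of_le_ne_top ENNReal.one_ne_top (P.prob_le_one E)

theorem dpDivergence_le_of_prob_le {S : Type*} {e δ : ℝ} (hδ : 0 ≤ δ) {P Q : SubDist S}
    (h : ∀ E, P.prob E ≤ ENNReal.ofReal (Real.exp e) * Q.prob E + ENNReal.ofReal δ) :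
    dpDivergence e P Q ≤ δ := by
  refine ciSup_le fun E => ?_
  have h1 := ENNReal.toReal_mono (by finiteness [prob_ne_top Q E]) (h E)
  rw [ENNReal.toReal_add (by finiteness [prob_ne_top Q E]) (by finiteness), ENNReal.toReal_mul,
    ENNReal.toReal_ofReal (Real.exp_pos e).le, ENNReal.toReal_ofReal hδ] at h1
  linarith

end SubDist

/-! ### Randomised response as the extremal pair. -/

theorem Real.sinh_le_mul_cosh {x : ℝ} (hx : 0 ≤ x) : Real.sinh x ≤ x * Real.cosh x := by
  have hd : ∀ y : ℝ, HasDerivAt (fun y => y * Real.cosh y - Real.sinh y) (y * Real.sinh y) y := by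
    intro y
    refine (((hasDerivAt_id' y).mul (Real.hasDerivAt_cosh y)).sub
      (Real.hasDerivAt_sinh y)).congr_deriv ?_
    ring
  have hmono : MonotoneOn (fun y => y * Real.cosh y - Real.sinh y) (Set.Ici (0 : ℝ)) := by
    refine monotoneOn_of_deriv_nonneg (convex_Ici 0)
      (fun y _ => (hd y).continuousAt.continuousWithinAt)
      (fun y _ => (hd y).differentiableAt.differentiableWithinAt) fun y hy => ?_
    rw [interior_Ici] at hy
    rw [(hd y).deriv]
    exact mul_nonneg (le_of_lt hy) (Real.sinh_nonneg_iff.2 (le_of_lt hy))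
  have := hmono (Set.mem_Ici.2 le_rfl) hx hx
  simp at this
  linarith

/-- The exponential moment of the privacy loss of randomised response. -/
theorem Real.randomizedResponse_moment_le {ε l : ℝ} (hε : 0 ≤ ε) (hl : 0 ≤ l) :
    Real.exp ((1 + l) * ε) + Real.exp (-(l * ε)) ≤
      Real.exp (l * (ε * (Real.exp ε - 1)) + (l * ε) ^ 2 / 2) * (1 + Real.exp ε) := by
  set h := l * ε with hh
  have hh0 : 0 ≤ h := mul_nonneg hl hε
  have hu : 1 ≤ Real.exp ε := Real.one_le_exp hε
  have e1 : Real.exp ((1 + l) * ε) + Real.exp (-h) =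
      (1 + Real.exp ε) * Real.cosh h + (Real.exp ε - 1) * Real.sinh h := by
    rw [Real.cosh_eq, Real.sinh_eq, add_mul, one_mul, ← hh, Real.exp_add]
    ring
  rw [e1]
  have hc := Real.cosh_pos h
  have hu1 : 0 ≤ Real.exp ε - 1 := sub_nonneg.2 hu
  calc (1 + Real.exp ε) * Real.cosh h + (Real.exp ε - 1) * Real.sinh h
      ≤ (1 + Real.exp ε) * Real.cosh h + (Real.exp ε - 1) * (h * Real.cosh h) := by
        gcongr
        exact Real.sinh_le_mul_cosh hh0
    -- The factor `1 + exp ε` is inserted at a loss: the sharp mean loss has (e^ε - 1)/(e^ε + 1)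
    -- where the stated bound has e^ε - 1.
    _ ≤ (1 + Real.exp ε) * Real.cosh h
          + (1 + Real.exp ε) * ((Real.exp ε - 1) * (h * Real.cosh h)) := by
        exact add_le_add le_rfl (le_mul_of_one_le_left (by positivity) (by linarith))
    _ = Real.cosh h * (h * (Real.exp ε - 1) + 1) * (1 + Real.exp ε) := by ring
    _ ≤ Real.exp (h ^ 2 / 2) * Real.exp (h * (Real.exp ε - 1)) * (1 + Real.exp ε) := by
        gcongr
        · exact Real.cosh_le_exp_half_sq h
        · exact Real.add_one_le_exp _
    _ = _ := by
        rw [← Real.exp_add, hh]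
        ring_nf

/-- Mass functions `p` and `q` of common weight that are pointwise within a factor `u` of each
other are obtained by post-processing randomised response. -/
theorem exists_randomizedResponse {S : Type*} {u : ℝ} (hu : 1 < u) {p q : S → ℝ}
    (hp : Summable p) (hq : Summable q) (hpq : ∀ x, p x ≤ u * q x) (hqp : ∀ x, q x ≤ u * p x)
    (hsum : ∑' x, p x = ∑' x, q x) :
    ∃ α β : S → ℝ, (∀ x, 0 ≤ α x) ∧ (∀ x, 0 ≤ β x) ∧ Summable α ∧ Summable β ∧
      (∀ x, p x = u * α x + β x) ∧ (∀ x, q x = α x + u * β x) ∧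
      (1 + u) * ∑' x, α x = ∑' x, p x ∧ (1 + u) * ∑' x, β x = ∑' x, p x := by
  have hv : 0 < u ^ 2 - 1 := by nlinarith
  have hsα : Summable fun x => (u * p x - q x) / (u ^ 2 - 1) :=
    ((hp.mul_left u).sub hq).div_const _
  have hsβ : Summable fun x => (u * q x - p x) / (u ^ 2 - 1) :=
    ((hq.mul_left u).sub hp).div_const _
  -- The witnesses solve the system p = uα + β, q = α + uβ, of determinant u² - 1. The ratio bounds
  -- make them nonnegative.
  refine ⟨fun x => (u * p x - q x) / (u ^ 2 - 1), fun x => (u * q x - p x) / (u ^ 2 - 1),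
    fun x => div_nonneg (sub_nonneg.2 (hqp x)) hv.le,
    fun x => div_nonneg (sub_nonneg.2 (hpq x)) hv.le, hsα, hsβ,
    fun x => by field_simp; ring, fun x => by field_simp; ring, ?_, ?_⟩
  · rw [tsum_div_const, (hp.mul_left u).tsum_sub hq, tsum_mul_left, ← hsum]
    field_simp
    ring
  · rw [tsum_div_const, (hq.mul_left u).tsum_sub hp, tsum_mul_left, ← hsum]
    field_simp
    ring

/-- Two distributions that are `(log u, δ)`-indistinguishable contain parts of common weight at
least `1 - δ` that are pointwise within a factor `u` of each other. -/
theorem exists_common_weight_parts {S : Type*} {u δ : ℝ} (hu : 1 ≤ u) {p q : S → ℝ}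
    (hp0 : ∀ x, 0 ≤ p x) (hq0 : ∀ x, 0 ≤ q x) (hp : Summable p) (hq : Summable q)
    (h1 : 1 - δ ≤ ∑' x, min (p x) (u * q x)) (h2 : 1 - δ ≤ ∑' x, min (q x) (u * p x)) :
    ∃ p' q' : S → ℝ, (∀ x, 0 ≤ p' x) ∧ (∀ x, 0 ≤ q' x) ∧ (∀ x, p' x ≤ p x) ∧
      (∀ x, q' x ≤ q x) ∧ (∀ x, p' x ≤ u * q' x) ∧ (∀ x, q' x ≤ u * p' x) ∧
      ∑' x, p' x = ∑' x, q' x ∧ 1 - δ ≤ ∑' x, p' x := by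
  wlog hle : ∑' x, min (q x) (u * p x) ≤ ∑' x, min (p x) (u * q x) generalizing p q
  · obtain ⟨q', p', a1, a2, a3, a4, a5, a6, a7, a8⟩ :=
      this hq0 hp0 hq hp h2 h1 (le_of_not_ge hle)
    exact ⟨p', q', a2, a1, a4, a3, a6, a5, a7.symm, a7 ▸ a8⟩
  have hu0 : 0 < u := by linarith
  set p₁ : S → ℝ := fun x => min (p x) (u * q x) with hp₁
  set q₁ : S → ℝ := fun x => min (q x) (u * p x) with hq₁
  have hp₁0 : ∀ x, 0 ≤ p₁ x := fun x => le_min (hp0 x) (mul_nonneg hu0.le (hq0 x))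
  have hq₁0 : ∀ x, 0 ≤ q₁ x := fun x => le_min (hq0 x) (mul_nonneg hu0.le (hp0 x))
  have hsp : Summable p₁ := Summable.of_nonneg_of_le hp₁0 (fun x => min_le_left _ _) hp
  have hsq : Summable q₁ := Summable.of_nonneg_of_le hq₁0 (fun x => min_le_left _ _) hq
  have hpq : ∀ x, p₁ x ≤ u * q₁ x := by
    intro x
    rw [hq₁, mul_min_of_nonneg _ _ hu0.le]
    refine le_min (min_le_right _ _) ((min_le_left _ _).trans ?_)
    have := hp0 x
    nlinarith [mul_nonneg (sub_nonneg.2 hu) this]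
  have hqp : ∀ x, q₁ x ≤ u * p₁ x := by
    intro x
    rw [hp₁, mul_min_of_nonneg _ _ hu0.le]
    refine le_min (min_le_right _ _) ((min_le_left _ _).trans ?_)
    have := hq0 x
    nlinarith [mul_nonneg (sub_nonneg.2 hu) this]
  have hlow : ∑' x, u⁻¹ * q₁ x ≤ ∑' x, q₁ x := by
    rw [tsum_mul_left]
    exact mul_le_of_le_one_left (tsum_nonneg hq₁0) (inv_le_one_of_one_le₀ hu)
  -- The truncations may differ in weight. The heavier `p₁` is lowered towards `u⁻¹ * q₁`, which
  -- lies below it pointwise, until its weight is that of `q₁`. Both ratio bounds survive convex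
  -- combination.
  obtain ⟨s, t, hs, ht, hst, hmix⟩ : ∃ s t : ℝ, 0 ≤ s ∧ 0 ≤ t ∧ s + t = 1 ∧
      s • (∑' x, u⁻¹ * q₁ x) + t • (∑' x, p₁ x) = ∑' x, q₁ x := by
    have := Icc_subset_segment (𝕜 := ℝ) (Set.mem_Icc.2 ⟨hlow, hle⟩)
    exact this
  have hlow' : ∀ x, u⁻¹ * q₁ x ≤ p₁ x := fun x => by
    rw [inv_mul_le_iff₀ hu0]; exact hqp x
  have hmass : ∑' x, (s * (u⁻¹ * q₁ x) + t * p₁ x) = ∑' x, q₁ x := by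
    rw [((hsq.mul_left _).mul_left _).tsum_add (hsp.mul_left _), tsum_mul_left,
      tsum_mul_left (f := p₁)]
    exact hmix
  have hup : ∀ x, s * (u⁻¹ * q₁ x) + t * p₁ x ≤ p₁ x := fun x => by
    calc s * (u⁻¹ * q₁ x) + t * p₁ x ≤ s * p₁ x + t * p₁ x := by
          gcongr; exact hlow' x
      _ = p₁ x := by rw [← add_mul, hst, one_mul]
  refine ⟨fun x => s * (u⁻¹ * q₁ x) + t * p₁ x, q₁, fun x => ?_, hq₁0,
    fun x => (hup x).trans (min_le_left _ _), fun x => min_le_left _ _,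
    fun x => (hup x).trans (hpq x), fun x => ?_, hmass, hmass ▸ h2⟩
  · have := hq₁0 x
    have := hp₁0 x
    positivity
  · rw [← inv_mul_le_iff₀ hu0]
    calc u⁻¹ * q₁ x = s * (u⁻¹ * q₁ x) + t * (u⁻¹ * q₁ x) := by rw [← add_mul, hst, one_mul]
      _ ≤ s * (u⁻¹ * q₁ x) + t * p₁ x := by gcongr; exact hlow' x

namespace SubDist

/-! ### From divergence bounds to moment closeness. -/

theorem apply_ne_top {S : Type*} (P : SubDist S) (x : S) : P x ≠ ∞ :=
  ne_top_of_le_ne_top ENNReal.one_ne_top ((ENNReal.le_tsum x).trans P.tsum_mass_le_one)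

theorem summable_toReal {S : Type*} (P : SubDist S) : Summable fun x => (P x).toReal :=
  ENNReal.summable_toReal (ne_top_of_le_ne_top ENNReal.one_ne_top P.tsum_mass_le_one)

theorem IsProper.tsum_toReal {S : Type*} {P : SubDist S} (hP : P.IsProper) :
    ∑' x, (P x).toReal = 1 := by
  have h : ∑' x, P x = 1 := hP
  rw [← ENNReal.tsum_toReal_eq P.apply_ne_top, h, ENNReal.toReal_one]

theorem toReal_prob {S : Type*} (P : SubDist S) (E : Set S) :
    (P.prob E).toReal = ∑' x, E.indicator (fun x => (P x).toReal) x := by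
  rw [prob, ENNReal.tsum_toReal_eq]
  · refine tsum_congr fun x => ?_
    by_cases hx : x ∈ E <;> simp [hx]
  · intro x
    by_cases hx : x ∈ E <;> simp [hx, apply_ne_top]

/-- The event where `P` exceeds e^ε `Q` carries exactly the mass removed by truncation, so the
divergence bound at this event suffices. -/
theorem one_sub_le_tsum_min {S : Type*} {ε δ : ℝ} {P Q : SubDist S} (hP : P.IsProper)
    (h : dpDivergence ε P Q ≤ δ) :
    1 - δ ≤ ∑' x, min (P x).toReal (Real.exp ε * (Q x).toReal) := by
  set u := Real.exp ε with hu
  have hu0 : 0 < u := Real.exp_pos ε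
  set E : Set S := {x | u * (Q x).toReal < (P x).toReal} with hE
  have hE' := (le_ciSup (bddAbove_dpDivergence ε P Q) E).trans h
  simp only [toReal_prob] at hE'
  have hp := P.summable_toReal
  have hq := Q.summable_toReal
  rw [← tsum_mul_left, ← (hp.indicator E).tsum_sub ((hq.indicator E).mul_left _)] at hE'
  have hmin : ∀ x, min (P x).toReal (u * (Q x).toReal) = (P x).toReal -
      (E.indicator (fun x => (P x).toReal) x - u * E.indicator (fun x => (Q x).toReal) x) := by
    intro x
    by_cases hx : x ∈ E
    · simp only [hx, Set.indicator_of_mem, sub_sub_cancel]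
      exact min_eq_right (le_of_lt hx)
    · simp only [hx, not_false_eq_true, Set.indicator_of_notMem, mul_zero, sub_zero]
      exact min_eq_left (not_lt.1 hx)
  simp only [hmin]
  rw [hp.tsum_sub ((hp.indicator E).sub ((hq.indicator E).mul_left _)), hP.tsum_toReal]
  linarith

theorem tsum_ofReal_sub_le {S : Type*} {δ : ℝ} {P : SubDist S} (hP : P.IsProper) {m : S → ℝ}
    (hm0 : ∀ x, 0 ≤ m x) (hm : ∀ x, m x ≤ (P x).toReal) (hδ : 1 - δ ≤ ∑' x, m x) :
    ∑' x, ENNReal.ofReal ((P x).toReal - m x) ≤ ENNReal.ofReal δ := by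
  have hs : Summable m := Summable.of_nonneg_of_le hm0 hm P.summable_toReal
  rw [← ENNReal.ofReal_tsum_of_nonneg (fun x => sub_nonneg.2 (hm x)) (P.summable_toReal.sub hs),
    P.summable_toReal.tsum_sub hs, hP.tsum_toReal]
  exact ENNReal.ofReal_le_ofReal (by linarith)

/-- The limit `l → ∞`. At exponent `a = 0` the weight `W` has no influence, and `W = 0` is allowed
because `0 ^ 0 = 1`. -/
theorem momentClose_zero_of_dpDivergence_le {S : Type*} {δ : ℝ} {P Q : SubDist S}
    (hP : P.IsProper) (h : dpDivergence 0 P Q ≤ δ) : MomentClose 0 1 (ENNReal.ofReal δ) P Q := by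
  refine ⟨fun x => ENNReal.ofReal ((P x).toReal - min (P x).toReal (Q x).toReal), 0, ?_, by simp,
    fun x => ?_⟩
  · refine tsum_ofReal_sub_le hP (fun x => by positivity) (fun x => min_le_left _ _) ?_
    simpa using one_sub_le_tsum_min hP h
  · have h1 : (P x).toReal ≤ (Q x).toReal + ((P x).toReal - min (P x).toReal (Q x).toReal) := by
      linarith [min_le_right (P x).toReal (Q x).toReal]
    have h2 := ENNReal.ofReal_le_ofReal h1
    rw [ENNReal.ofReal_add ENNReal.toReal_nonneg (sub_nonneg.2 (min_le_left _ _)),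
      ENNReal.ofReal_toReal (P.apply_ne_top x), ENNReal.ofReal_toReal (Q.apply_ne_top x)] at h2
    simpa using h2

/-- For `a = (1 + l)⁻¹` one has `1 - a = l * a`, so the powers of `r` cancel. An atom with masses
`y` and `y / r` thus has moment `r ^ l * y`. -/
theorem rpow_inv_mul_rpow {l r : ℝ} (hl : 0 ≤ l) (hr : 0 < r) (y : ℝ≥0∞) :
    (ENNReal.ofReal (r ^ l) * y) ^ (1 + l)⁻¹ * (ENNReal.ofReal r⁻¹ * y) ^ (1 - (1 + l)⁻¹) = y := by
  have ha : 0 ≤ (1 + l)⁻¹ := by positivity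
  have ha1 : 0 ≤ 1 - (1 + l)⁻¹ := sub_nonneg.2 (inv_le_one_of_one_le₀ (by linarith))
  rw [ENNReal.mul_rpow_of_nonneg _ _ ha, ENNReal.mul_rpow_of_nonneg _ _ ha1, mul_mul_mul_comm,
    ← ENNReal.rpow_add_of_nonneg _ _ ha ha1, ENNReal.ofReal_rpow_of_pos (by positivity),
    ENNReal.ofReal_rpow_of_pos (by positivity), ← ENNReal.ofReal_mul (by positivity),
    ← Real.rpow_mul hr.le, Real.inv_rpow hr.le, ← Real.rpow_neg hr.le, ← Real.rpow_add hr]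
  have : l * (1 + l)⁻¹ + -(1 - (1 + l)⁻¹) = 0 := by field_simp; ring
  rw [this]
  simp

theorem momentClose_of_dpDivergence_le {S : Type*} {ε δ l : ℝ} (hε : 0 < ε) (hl : 0 ≤ l)
    {P Q : SubDist S} (hP : P.IsProper) (hQ : Q.IsProper) (h₁ : dpDivergence ε P Q ≤ δ)
    (h₂ : dpDivergence ε Q P ≤ δ) :
    MomentClose (1 + l)⁻¹
      (ENNReal.ofReal (Real.exp (l * (ε * (Real.exp ε - 1)) + (l * ε) ^ 2 / 2)))
      (ENNReal.ofReal δ) P Q := by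
  set u := Real.exp ε with hu
  have hu1 : 1 < u := Real.one_lt_exp_iff.2 hε
  have hu0 : 0 < u := Real.exp_pos ε
  obtain ⟨p, q, hp0, hq0, hpP, hqQ, hpq, hqp, hsum, hmass⟩ :=
    exists_common_weight_parts hu1.le (fun x => ENNReal.toReal_nonneg)
      (fun x => ENNReal.toReal_nonneg) P.summable_toReal Q.summable_toReal
      (one_sub_le_tsum_min hP h₁) (one_sub_le_tsum_min hQ h₂)
  have hsp : Summable p := Summable.of_nonneg_of_le hp0 hpP P.summable_toReal
  have hsq : Summable q := Summable.of_nonneg_of_le hq0 hqQ Q.summable_toReal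
  have hp1 : ∑' x, p x ≤ 1 := hP.tsum_toReal ▸ hsp.tsum_le_tsum hpP P.summable_toReal
  obtain ⟨α, β, hα0, hβ0, hα, hβ, hpe, hqe, hαs, hβs⟩ :=
    exists_randomizedResponse hu1 hsp hsq hpq hqp hsum
  have ha : 0 ≤ (1 + l)⁻¹ := by positivity
  have ha1 : 0 ≤ 1 - (1 + l)⁻¹ := sub_nonneg.2 (inv_le_one_of_one_le₀ (by linarith))
  -- `A` and `B` are the moments P^(1+l) Q^(-l) of the two randomised-response outcomes, with masses
  -- `u * α` against `α` and `β` against `u * β`.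
  set A : S → ℝ≥0∞ := fun x => ENNReal.ofReal (u ^ l) * ENNReal.ofReal (u * α x)
  set B : S → ℝ≥0∞ := fun x => ENNReal.ofReal (u⁻¹ ^ l) * ENNReal.ofReal (β x)
  refine ⟨fun x => ENNReal.ofReal ((P x).toReal - p x), fun x => A x + B x,
    tsum_ofReal_sub_le hP hp0 hpP hmass, ?_, fun x => ?_⟩
  · have hA : ∀ x, A x + B x = ENNReal.ofReal (u ^ l * (u * α x) + u⁻¹ ^ l * β x) := by
      intro x
      have := hα0 x
      have := hβ0 x
      rw [ENNReal.ofReal_add (by positivity) (by positivity), ENNReal.ofReal_mul (by positivity),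
        ENNReal.ofReal_mul (p := u⁻¹ ^ l) (by positivity)]
    simp only [hA]
    rw [← ENNReal.ofReal_tsum_of_nonneg]
    · refine ENNReal.ofReal_le_ofReal ?_
      rw [((hα.mul_left u).mul_left _).tsum_add (hβ.mul_left _), tsum_mul_left, tsum_mul_left,
        tsum_mul_left]
      have key := Real.randomizedResponse_moment_le hε.le hl
      have e1 : Real.exp ((1 + l) * ε) = u ^ l * u := by
        rw [hu, ← Real.exp_mul, ← Real.exp_add]; ring_nf
      have e2 : Real.exp (-(l * ε)) = u⁻¹ ^ l := by
        rw [hu, ← Real.exp_neg, ← Real.exp_mul]; ring_nf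
      rw [e1, e2] at key
      have hαβ : ∑' x, α x = ∑' x, β x :=
        mul_left_cancel₀ (by positivity : 1 + u ≠ 0) (hαs.trans hβs.symm)
      have hβ1 : (1 + u) * ∑' x, β x ≤ 1 := hβs.trans_le hp1
      have hβ0' : 0 ≤ ∑' x, β x := tsum_nonneg hβ0
      rw [hαβ]
      set K := Real.exp (l * (ε * (u - 1)) + (l * ε) ^ 2 / 2)
      have hK : 0 ≤ K := (Real.exp_pos _).le
      calc u ^ l * (u * ∑' x, β x) + u⁻¹ ^ l * ∑' x, β x
          = (u ^ l * u + u⁻¹ ^ l) * ∑' x, β x := by ring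
        _ ≤ K * (1 + u) * ∑' x, β x := by gcongr
        _ = K * ((1 + u) * ∑' x, β x) := by ring
        _ ≤ K * 1 := by gcongr
        _ = K := mul_one K
    · intro x
      have := hα0 x
      have := hβ0 x
      positivity
    · exact ((hα.mul_left u).mul_left _).add (hβ.mul_left _)
  · have hQx : ENNReal.ofReal (α x) + ENNReal.ofReal (u * β x) ≤ Q x := by
      rw [← ENNReal.ofReal_add (hα0 x) (mul_nonneg hu0.le (hβ0 x)), ← hqe]
      exact ENNReal.ofReal_le_of_le_toReal (hqQ x)
    have hPx : P x = ENNReal.ofReal (u * α x) + ENNReal.ofReal (β x)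
        + ENNReal.ofReal ((P x).toReal - p x) := by
      rw [← ENNReal.ofReal_add (mul_nonneg hu0.le (hα0 x)) (hβ0 x), ← hpe,
        ← ENNReal.ofReal_add (hp0 x) (sub_nonneg.2 (hpP x)), add_sub_cancel,
        ENNReal.ofReal_toReal (P.apply_ne_top x)]
    have e1 : ENNReal.ofReal (u * α x) =
        A x ^ (1 + l)⁻¹ * ENNReal.ofReal (α x) ^ (1 - (1 + l)⁻¹) := by
      have := rpow_inv_mul_rpow hl hu0 (ENNReal.ofReal (u * α x))
      rw [← ENNReal.ofReal_mul (by positivity : 0 ≤ u⁻¹), inv_mul_cancel_left₀ hu0.ne'] at this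
      exact this.symm
    have e2 : ENNReal.ofReal (β x) =
        B x ^ (1 + l)⁻¹ * ENNReal.ofReal (u * β x) ^ (1 - (1 + l)⁻¹) := by
      have := rpow_inv_mul_rpow hl (inv_pos.2 hu0) (ENNReal.ofReal (β x))
      rw [inv_inv, ← ENNReal.ofReal_mul hu0.le] at this
      exact this.symm
    -- Two-term Hölder merges both outcomes into one geometric mean at `x`.
    have hold := ENNReal.tsum_rpow_mul_rpow_le (fun b : Bool => cond b (A x) (B x))
      (fun b : Bool => cond b (ENNReal.ofReal (α x)) (ENNReal.ofReal (u * β x))) ha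
      (sub_nonneg.1 ha1)
    simp only [tsum_bool, cond_true, cond_false] at hold
    rw [← e1, ← e2, add_comm, add_comm (B x), add_comm (ENNReal.ofReal (u * β x))] at hold
    rw [hPx]
    gcongr
    exact hold.trans (by gcongr)

/-! ### Composition of liftings. -/

/-- A symmetric `⋆`-lifting whose witnesses are related by `MomentClose` in both directions. -/
def MomentLift {A : Type u} {B : Type v} (a : ℝ) (C d : ℝ≥0∞) (R : A → B → Prop)
    (μ : SubDist A) (ν : SubDist B) : Prop :=
  ∃ (ηL : SubDist (A × Option B)) (ηR : SubDist (Option A × B)),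
    ηL.map Prod.fst = μ ∧ ηR.map Prod.snd = ν ∧
    (∀ x y, ηL (x, some y) ≠ 0 → R x y) ∧ (∀ x y, ηR (some x, y) ≠ 0 → R x y) ∧
    MomentClose a C d (ηL.map (Prod.map some id) : SubDist (Option A × Option B))
      (ηR.map (Prod.map id some)) ∧
    MomentClose a C d (ηR.map (Prod.map id some) : SubDist (Option A × Option B))
      (ηL.map (Prod.map some id))

theorem MomentLift.dirac {A : Type u} {B : Type v} {a : ℝ} (ha : 0 ≤ a) (ha1 : a ≤ 1)
    {R : A → B → Prop} {x : A} {y : B} (h : R x y) :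
    MomentLift a 1 0 R (SubDist.dirac x) (SubDist.dirac y) := by
  refine ⟨SubDist.dirac (x, some y), SubDist.dirac (some x, y), map_dirac _ _, map_dirac _ _,
    fun x' y' h' => ?_, fun x' y' h' => ?_, ?_, ?_⟩
  · have := dirac_apply_ne_zero h'
    simp only [Prod.mk.injEq, Option.some.injEq] at this
    rwa [this.1, this.2]
  · have := dirac_apply_ne_zero h'
    simp only [Prod.mk.injEq, Option.some.injEq] at this
    rwa [this.1, this.2]
  all_goals
    simp only [map_dirac, Prod.map_apply, id]
    exact MomentClose.refl ha ha1 le_rfl 0 _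

/-- Related pairs continue with the given witnesses. A sample paired with `⋆` continues alone and
remains paired with `⋆`, which preserves the marginals. -/
theorem MomentLift.bind {A A' : Type u} {B B' : Type v} {a : ℝ} (ha : 0 ≤ a) (ha1 : a ≤ 1)
    {C₁ C₂ d₁ d₂ : ℝ≥0∞} (hC₂ : 1 ≤ C₂) {R : A → B → Prop} {R' : A' → B' → Prop}
    {μ : SubDist A} {ν : SubDist B} {f : A → SubDist A'} {g : B → SubDist B'}
    (h : MomentLift a C₁ d₁ R μ ν)
    (hfg : ∀ x y, R x y → MomentLift a C₂ d₂ R' (f x) (g y)) :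
    MomentLift a (C₁ * C₂) (d₁ + d₂) R' (μ.bind f) (ν.bind g) := by
  classical
  obtain ⟨ηL, ηR, hL, hR, sL, sR, cLR, cRL⟩ := h
  choose κL κR kL kR tL tR kLR kRL using hfg
  let fL : A → SubDist (A' × Option B') := fun x => (f x).map fun x' => (x', none)
  let gR : B → SubDist (Option A' × B') := fun y => (g y).map fun y' => (none, y')
  let KL : A × Option B → SubDist (A' × Option B')
    | (x, none) => fL x
    | (x, some y) => if h : R x y then κL x y h else zero _
  let KR : Option A × B → SubDist (Option A' × B')
    | (none, y) => gR y
    | (some x, y) => if h : R x y then κR x y h else zero _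
  -- Extended kernels on the common space. `JL` is free on states `(none, _)`, which carry no mass
  -- of the extended `ηL`, and `JR` on states `(_, none)` for the extended `ηR`. There each is
  -- chosen equal to the other, so closeness is reflexive and needs `1 ≤ C₂`.
  let JL : Option A × Option B → SubDist (Option A' × Option B')
    | (some x, y) => (KL (x, y)).map (Prod.map some id)
    | (none, some y) => (gR y).map (Prod.map id some)
    | (none, none) => zero _
  let JR : Option A × Option B → SubDist (Option A' × Option B')
    | (x, some y) => (KR (x, y)).map (Prod.map id some)
    | (some x, none) => (fL x).map (Prod.map some id)
    | (none, none) => zero _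
  have hJL : (ηL.bind KL).map (Prod.map some id) = (ηL.map (Prod.map some id)).bind JL := by
    rw [map_bind, bind_map]
    rfl
  have hJR : (ηR.bind KR).map (Prod.map id some) = (ηR.map (Prod.map id some)).bind JR := by
    rw [map_bind, bind_map]
    rfl
  have hclose : ∀ s, MomentClose a C₂ d₂ (JL s) (JR s) ∧ MomentClose a C₂ d₂ (JR s) (JL s) := by
    rintro ⟨_ | x, _ | y⟩
    · exact ⟨.refl ha ha1 hC₂ _ _, .refl ha ha1 hC₂ _ _⟩
    · exact ⟨.refl ha ha1 hC₂ _ _, .refl ha ha1 hC₂ _ _⟩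
    · exact ⟨.refl ha ha1 hC₂ _ _, .refl ha ha1 hC₂ _ _⟩
    · by_cases hxy : R x y
      · simp only [JL, JR, KL, KR, dif_pos hxy]
        exact ⟨kLR x y hxy, kRL x y hxy⟩
      · simp only [JL, JR, KL, KR, dif_neg hxy, zero_map]
        exact ⟨.refl ha ha1 hC₂ _ _, .refl ha ha1 hC₂ _ _⟩
  refine ⟨ηL.bind KL, ηR.bind KR, ?_, ?_, fun x' y' h' => ?_, fun x' y' h' => ?_, ?_, ?_⟩
  · rw [map_bind, ← hL, bind_map]
    refine bind_congr _ ?_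
    rintro ⟨x, _ | y⟩ hs
    · simp only [KL, fL, map_map]
      exact map_id _
    · simp only [KL, dif_pos (sL x y hs), kL]
  · rw [map_bind, ← hR, bind_map]
    refine bind_congr _ ?_
    rintro ⟨_ | x, y⟩ hs
    · simp only [KR, gR, map_map]
      exact map_id _
    · simp only [KR, dif_pos (sR x y hs), kR]
  · obtain ⟨⟨x, _ | y⟩, hs, hs'⟩ := bind_apply_ne_zero h'
    · obtain ⟨z, -, hz⟩ := map_apply_ne_zero hs'
      simp at hz
    · simp only [KL, dif_pos (sL x y hs)] at hs'
      exact tL x y _ x' y' hs'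
  · obtain ⟨⟨_ | x, y⟩, hs, hs'⟩ := bind_apply_ne_zero h'
    · obtain ⟨z, -, hz⟩ := map_apply_ne_zero hs'
      simp at hz
    · simp only [KR, dif_pos (sR x y hs)] at hs'
      exact tR x y _ x' y' hs'
  · rw [hJL, hJR]
    exact cLR.bind ha ha1 fun s => (hclose s).1
  · rw [hJL, hJR]
    exact cRL.bind ha ha1 fun s => (hclose s).2

theorem momentLift_kleisliComp {n : ℕ} {A : Fin (n + 1) → Type u} {B : Fin (n + 1) → Type v}
    {R : (i : Fin (n + 1)) → A i → B i → Prop}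
    {f : (i : Fin n) → A i.castSucc → SubDist (A i.succ)}
    {g : (i : Fin n) → B i.castSucc → SubDist (B i.succ)}
    {a : ℝ} (ha : 0 ≤ a) (ha1 : a ≤ 1) {C d : ℝ≥0∞} (hC : 1 ≤ C)
    (hfg : ∀ i x y, R i.castSucc x y → MomentLift a C d (R i.succ) (f i x) (g i y))
    {a₀ : A 0} {b₀ : B 0} (h₀ : R 0 a₀ b₀) :
    MomentLift a (C ^ n) (n * d) (R (Fin.last n)) (kleisliComp f a₀) (kleisliComp g b₀) := by
  have key : ∀ i : Fin (n + 1),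
      MomentLift a (C ^ (i : ℕ)) ((i : ℕ) * d) (R i) (run f a₀ i) (run g b₀ i) := by
    intro i
    induction i using Fin.induction with
    | zero => simpa [run] using MomentLift.dirac ha ha1 h₀
    | succ j ih =>
      have := ih.bind ha ha1 hC (hfg j)
      simp only [Fin.val_succ, pow_succ, Nat.cast_add, Nat.cast_one, add_mul, one_mul]
      exact this
  exact key (Fin.last n)

/-- A symmetric `⋆`-lifting of proper distributions is witnessed by proper distributions. -/
theorem SymStarLift.momentLift {A : Type u} {B : Type v} {a : ℝ} {C d : ℝ≥0∞} {ε δ : ℝ}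
    {R : A → B → Prop} {μ : SubDist A} {ν : SubDist B} (h : SymStarLift R ε δ μ ν)
    (hμ : μ.IsProper) (hν : ν.IsProper)
    (hclose : ∀ P Q : SubDist (Option A × Option B), P.IsProper → Q.IsProper →
      dpDivergence ε P Q ≤ δ → dpDivergence ε Q P ≤ δ → MomentClose a C d P Q) :
    MomentLift a C d R μ ν := by
  obtain ⟨ηL, ηR, h⟩ := h
  have hL : (ηL.map (Prod.map some id) : SubDist (Option A × Option B)).IsProper := by
    rw [IsProper, weight_map, ← weight_map ηL Prod.fst, h.fst_marginal]
    exact hμ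
  have hR : (ηR.map (Prod.map id some) : SubDist (Option A × Option B)).IsProper := by
    rw [IsProper, weight_map, ← weight_map ηR Prod.snd, h.snd_marginal]
    exact hν
  exact ⟨ηL, ηR, h.fst_marginal, h.snd_marginal, h.left_support, h.right_support,
    hclose _ _ hL hR h.left_right h.right_left, hclose _ _ hR hL h.right_left h.left_right⟩

theorem MomentLift.symStarLift {A : Type u} {B : Type v} {a : ℝ} (ha : 0 ≤ a) (ha1 : a ≤ 1)
    {C d s : ℝ≥0∞} {ε δ : ℝ} (hδ : 0 ≤ δ) {R : A → B → Prop} {μ : SubDist A} {ν : SubDist B}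
    (h : MomentLift a C d R μ ν) (hs : s ^ a * ENNReal.ofReal (Real.exp ε) ^ (1 - a) = 1)
    (hsδ : d + s * C ≤ ENNReal.ofReal δ) : SymStarLift R ε δ μ ν := by
  obtain ⟨ηL, ηR, hL, hR, sL, sR, cLR, cRL⟩ := h
  exact ⟨ηL, ηR, hL, hR, sL, sR,
    dpDivergence_le_of_prob_le hδ fun E => (cLR.prob_le ha ha1 hs E).trans (by gcongr),
    dpDivergence_le_of_prob_le hδ fun E => (cRL.prob_le ha ha1 hs E).trans (by gcongr)⟩

end SubDist

/-! ### The corollary: choice of the moment order. -/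

theorem corollaryc (n : ℕ) (ε δ ω : ℝ) (hε : 0 ≤ ε) (hδ : 0 ≤ δ) (hω : ω ∈ Set.Ioo (0 : ℝ) 1)
    (A : Fin (n + 1) → Type u) (B : Fin (n + 1) → Type v)
    (R : (i : Fin (n + 1)) → A i → B i → Prop)
    (f : (i : Fin n) → A i.castSucc → SubDist (A i.succ))
    (g : (i : Fin n) → B i.castSucc → SubDist (B i.succ))
    (hlift : ∀ (i : Fin n) (a : A i.castSucc) (b : B i.castSucc), R i.castSucc a b →
      SubDist.SymStarLift (R i.succ) ε δ (f i a) (g i b))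
    (hproper : ∀ (i : Fin n) (a : A i.castSucc) (b : B i.castSucc), R i.castSucc a b →
      (f i a).IsProper ∧ (g i b).IsProper)
    (a₀ : A 0) (b₀ : B 0) (h₀ : R 0 a₀ b₀) :
    SubDist.SymStarLift (R (Fin.last n))
      (ε * Real.sqrt (2 * n * Real.log (1 / ω)) + n * ε * (Real.exp ε - 1))
      (n * δ + ω)
      (SubDist.kleisliComp f a₀) (SubDist.kleisliComp g b₀) := by
  obtain ⟨hω0, hω1⟩ := hω
  have hδ' : 0 ≤ n * δ + ω := by positivity
  have hofReal : (n : ℝ≥0∞) * ENNReal.ofReal δ = ENNReal.ofReal (n * δ) := by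
    rw [ENNReal.ofReal_mul (Nat.cast_nonneg n), ENNReal.ofReal_natCast]
  -- The order `l` below divides by `n * ε`, and the randomised-response decomposition needs e^ε >
  -- 1.
  by_cases hdeg : n = 0 ∨ ε = 0
  · -- the two compositions differ only by the additive errors
    have hε' : ε * Real.sqrt (2 * n * Real.log (1 / ω)) + n * ε * (Real.exp ε - 1) = 0 := by
      rcases hdeg with rfl | rfl <;> simp
    have hlift' : ∀ i x y, R i.castSucc x y →
        SubDist.MomentLift 0 1 (ENNReal.ofReal δ) (R i.succ) (f i x) (g i y) := by
      intro i x y hxy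
      have hε0 : ε = 0 := by
        rcases hdeg with rfl | h
        · exact i.elim0
        · exact h
      subst hε0
      exact (hlift i x y hxy).momentLift (hproper i x y hxy).1 (hproper i x y hxy).2
        fun P Q hP _ h _ => SubDist.momentClose_zero_of_dpDivergence_le hP h
    have := SubDist.momentLift_kleisliComp le_rfl zero_le_one le_rfl hlift' h₀
    -- At `a = 0` the constraint holds with `s = 0`, again by `0 ^ 0 = 1`, and the moment term
    -- vanishes.
    refine this.symStarLift (s := 0) le_rfl zero_le_one hδ' ?_ ?_
    · rw [hε']; simp
    · rw [zero_mul, add_zero, hofReal]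
      exact ENNReal.ofReal_le_ofReal (by linarith)
  · push Not at hdeg
    obtain ⟨hn, hε1⟩ := hdeg
    have hn' : (0 : ℝ) < n := Nat.cast_pos.2 (Nat.pos_of_ne_zero hn)
    have hε0 : 0 < ε := lt_of_le_of_ne hε (Ne.symm hε1)
    set L := Real.log (1 / ω) with hL
    have hL0 : 0 ≤ L := Real.log_nonneg (by rw [one_le_div hω0]; exact hω1.le)
    set r := Real.sqrt (2 * n * L) with hr
    have hr0 : 0 ≤ r := Real.sqrt_nonneg _
    have hrr : r ^ 2 = 2 * n * L := Real.sq_sqrt (by positivity)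
    -- Minimises the exponent n(lε)²/2 - lεr of the tail bound.
    set l := r / (n * ε) with hl
    have hl0 : 0 ≤ l := by positivity
    have ha : 0 ≤ (1 + l)⁻¹ := by positivity
    have ha1 : (1 + l)⁻¹ ≤ 1 := inv_le_one_of_one_le₀ (by linarith)
    set c := l * (ε * (Real.exp ε - 1)) + (l * ε) ^ 2 / 2 with hc
    set ε' := ε * r + n * ε * (Real.exp ε - 1) with hε'
    have hexp : 0 ≤ Real.exp ε - 1 := sub_nonneg.2 (Real.one_le_exp hε)
    have hc0 : 0 ≤ c := by positivity
    have hlift' : ∀ i x y, R i.castSucc x y →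
        SubDist.MomentLift (1 + l)⁻¹ (ENNReal.ofReal (Real.exp c)) (ENNReal.ofReal δ) (R i.succ)
          (f i x) (g i y) := fun i x y hxy =>
      (hlift i x y hxy).momentLift (hproper i x y hxy).1 (hproper i x y hxy).2
        fun P Q hP hQ h h' => SubDist.momentClose_of_dpDivergence_le hε0 hl0 hP hQ h h'
    have := SubDist.momentLift_kleisliComp ha ha1
      (ENNReal.one_le_ofReal.2 (Real.one_le_exp hc0)) hlift' h₀
    refine this.symStarLift (s := ENNReal.ofReal (Real.exp (-(l * ε')))) ha ha1 hδ' ?_ ?_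
    · rw [ENNReal.ofReal_rpow_of_pos (Real.exp_pos _), ENNReal.ofReal_rpow_of_pos (Real.exp_pos _),
        ← ENNReal.ofReal_mul (by positivity), ← Real.exp_mul, ← Real.exp_mul, ← Real.exp_add]
      have : -(l * ε') * (1 + l)⁻¹ + ε' * (1 - (1 + l)⁻¹) = 0 := by field_simp; ring
      rw [this]
      simp
    -- The terms l n ε(e^ε - 1) cancel, leaving -r²/(2n) = ln ω.
    · have hexponent : -(l * ε') + n * c = Real.log ω := by
        have hlε : l * ε * n = r := by rw [hl]; field_simp
        have hlog : L = -Real.log ω := by rw [hL, one_div, Real.log_inv]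
        have h1 : n * (-(l * ε') + n * c) = n * Real.log ω := by
          calc n * (-(l * ε') + n * c) = -(l * ε * n) * r + (l * ε * n) ^ 2 / 2 := by
                rw [hε', hc]; ring
            _ = -(r ^ 2) / 2 := by rw [hlε]; ring
            _ = n * Real.log ω := by rw [hrr, hlog]; ring
        exact mul_left_cancel₀ hn'.ne' h1
      rw [hofReal, ← ENNReal.ofReal_pow (Real.exp_pos _).le, ← Real.exp_nat_mul,
        ← ENNReal.ofReal_mul (Real.exp_pos _).le, ← Real.exp_add, hexponent, Real.exp_log hω0,
        ← ENNReal.ofReal_add (by positivity) hω0.le]
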